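/- All graphs are finite, undirected, with positive real edge weights. Let $G=(V,E,w)$ be such a graph, and write $\operatorname{dist}_G(u,v)$ for its shortest-path distance (equal to $\infty$ if $u,v$ are in different components). For a set $H\subseteq\binom V2$ of unordered pairs of distinct vertices, let $G'=(V,E\cup H)$ be the graph in which every edge $\{u,v\}\in H$ has weight $\operatorname{dist}_G(u,v)$ and every edge of $E\setminus H$ keeps its weight. For an integer $\beta\ge 1$ let $\operatorname{dist}^{(\beta)}_{G'}(u,v)$ be the least length of a path from $u$ to $v$ in $G'$ that uses at most $\beta$ edges ($\infty$ if there is none). For $\varepsilon>0$, the set $H$ is a $(\beta,\varepsilon)$-hopset for $G$ if $\operatorname{dist}^{(\beta)}_{G'}(u,v)\le(1+\varepsilon)\operatorname{dist}_G(u,v)$ for all $u,v\in V$. **Theorem.** For every integer $k\ge 1$ there is a constant $c_k>0$, depending only on $k$, such that the following holds. Let $\delta>0$, and let $\varepsilon=\varepsilon(n)$ satisfy $\varepsilon(n)>1/n^{o(1)}$, that is, for some function $f$ with $f(n)\to 0$ we have $\varepsilon(n)>1/n^{f(n)}$ for all sufficiently large $n$. Then for all sufficiently large $n$ and every integer $\beta\ge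 1$: if every weighted graph on $n$ vertices has a $(\beta,\varepsilon(n))$-hopset with at most $n^{1+\frac{1}{2^k-1}-\delta}$ edges, then $$\beta\ \ge\ c_k\left(\frac{1}{\varepsilon(n)}\right)^k .$$ In other words, any construction of $(\beta,\varepsilon)$-hopsets of worst-case size $n^{1+\frac1{2^k-1}-\delta}$ has $\beta=\Omega_k\big((1/\varepsilon)^k\big)$. -/

import Mathlib

open scoped ENNReal
open Filter Topology

noncomputable section

/-- An undirected weighted graph on `V`: a simple graph with a positive real weight on every edge
(the value of `weight` on pairs that are not edges is never used). -/
structure WeightedGraph (V : Type*) where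
  graph : SimpleGraph V
  weight : Sym2 V → ℝ
  weight_pos : ∀ e ∈ graph.edgeSet, 0 < weight e

/-- The total length of a walk with respect to edge lengths `w` (edges counted with
multiplicity). -/
def walkLength {V : Type*} {G : SimpleGraph V} (w : Sym2 V → ℝ≥0∞) {u v : V}
    (p : G.Walk u v) : ℝ≥0∞ :=
  (p.edges.map w).sum

/-- The `β`-limited distance: the least length of a walk from `u` to `v` with at most `β` edges,
and `∞` if there is none. -/
def hopLimitedDist {V : Type*} (G : SimpleGraph V) (w : Sym2 V → ℝ≥0∞) (β : ℕ) (u v : V) :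
    ℝ≥0∞ :=
  ⨅ (p : G.Walk u v) (_ : p.length ≤ β), walkLength w p

namespace WeightedGraph

variable {V : Type*} (G : WeightedGraph V)

/-- Edge weights as extended nonnegative reals. -/
def edgeLength (e : Sym2 V) : ℝ≥0∞ := ENNReal.ofReal (G.weight e)

/-- The shortest-path distance of a weighted graph, `∞` between different components. -/
def dist (u v : V) : ℝ≥0∞ :=
  ⨅ p : G.graph.Walk u v, walkLength G.edgeLength p

theorem dist_comm (u v : V) : G.dist u v = G.dist v u := by
  have key : ∀ a b : V, G.dist a b ≤ G.dist b a := by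
    intro a b
    refine le_iInf fun p => (iInf_le _ p.reverse).trans (le_of_eq ?_)
    simp [walkLength, SimpleGraph.Walk.edges_reverse, List.map_reverse, List.sum_reverse]
  exact le_antisymm (key u v) (key v u)

/-- The shortest-path distance as a function of unordered pairs. -/
def pairDist : Sym2 V → ℝ≥0∞ :=
  Sym2.lift ⟨G.dist, G.dist_comm⟩

/-- The underlying graph `(V, E ∪ H)` of the united graph. -/
def unitedGraph (H : Finset (Sym2 V)) : SimpleGraph V :=
  G.graph ⊔ SimpleGraph.fromEdgeSet (H : Set (Sym2 V))

open Classical in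
/-- The weights of the united graph: an edge of `H` weighs the distance in `G` between its
endpoints, every other edge keeps its weight. -/
def unitedLength (H : Finset (Sym2 V)) (e : Sym2 V) : ℝ≥0∞ :=
  if e ∈ H then G.pairDist e else G.edgeLength e

/-- `H` is a `(β, ε)`-hopset for `G`: a set of unordered pairs of distinct vertices such that the
`β`-limited distance in the united graph is within a factor `1 + ε` of the distance in `G`. -/
def IsHopset (β : ℕ) (ε : ℝ) (H : Finset (Sym2 V)) : Prop :=
  (∀ e ∈ H, ¬ e.IsDiag) ∧
    ∀ u v : V, hopLimitedDist (G.unitedGraph H) (G.unitedLength H) β u v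
      ≤ ENNReal.ofReal (1 + ε) * G.dist u v

end WeightedGraph

/-- Every weighted graph on `n` vertices has a `(β, ε)`-hopset with at most `s` edges. -/
def HasHopsetsOfSize (n β : ℕ) (ε s : ℝ) : Prop :=
  ∀ G : WeightedGraph (Fin n), ∃ H : Finset (Sym2 (Fin n)), G.IsHopset β ε H ∧ (H.card : ℝ) ≤ s

end

/-! The hard graph has far more port pairs than vertices, and each ordered vertex pair is a shortcut
for at most one port pair. A hopset with fewer than half as many edges as there are port pairs
therefore misses every shortcut of some port pair `p`. Replacing each hop by a shortest path gives a
run for `p`: its marks are the hops, and its backward edges account for all excess length. It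
remains to show that such a run has many marks or large excess; this is the linear trade-off
`HopBound`.

Gadgets are built recursively by `subst`. A path has `h` rounds; a round adds `g a` to the first
coordinate, crosses a copy of the smaller gadget from port `a` to port `b`, and adds `g b` to the
second. The canonical path of a port pair repeats one choice `(a, b)`. Since the range of `g` is
average-free, `h` steps with the right sum must all be equal, so a run that never goes back over a
long connecting edge stays on the canonical parts (`onPath_of_run`). Skipping a copy would be a
shortcut, so each of the `h` copies contains a mark and pays its own trade-off (`splits_of_run`).
Thus hops and excess are both multiplied by `h`.

After `k` rounds of recursion from a point, up to small powers of `X` and powers of `h`, there are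
`X ^ 2 ^ (k + 1)` port pairs on `X ^ (2 * (2 ^ k - 1))` vertices, an exponent ratio of `1 + 1 / (2 ^
k - 1)`. The hop and excess scales are `h ^ k` and the length is `2 * k * h ^ (k + 1)`; taking `h`
of order `1 / ε` keeps the allowed excess below half its scale. Behrend's spheres supply the
average-free families with little loss in size. -/

/-! ### Gadgets, runs and hop bounds -/

/-- A directed graph with a potential (an edge from `u` to `v` has length `pot v - pot u`), input
and output ports indexed by `I`, a family of port pairs indexed by `J`, and a relation `serve` such
that every ordered pair of vertices is a shortcut for at most one port pair. -/
structure Gadget (I J V : Type) where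
  adj : V → V → Prop
  pot : V → ℕ
  inp : I → V
  out : I → V
  src : J → I
  tgt : J → I
  serve : V → V → J → Prop
  len : ℕ
  pot_lt : ∀ {u v}, adj u v → pot u < pot v
  pot_inp : ∀ a, pot (inp a) = 0
  pot_out : ∀ b, pot (out b) = len
  pair_inj : ∀ {p q}, src p = src q → tgt p = tgt q → p = q
  serve_unique : ∀ {u v p q}, serve u v p → serve u v q → p = q
  not_serve_self : ∀ u p, ¬ serve u u p
  -- Edges are never shortcuts in either direction, so a hop along an original edge is always
  -- admissible in a run.
  not_serve_adj : ∀ {u v}, adj u v → ∀ p, ¬ serve u v p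
  not_serve_adj_symm : ∀ {u v}, adj u v → ∀ p, ¬ serve v u p
  reach : ∀ p, Relation.ReflTransGen adj (inp (src p)) (out (tgt p))

namespace Gadget

variable {I J V : Type}

/-- `G.Run p e κ u m c`: there is a walk from `u` to `e` with `m` marked vertices on it such that
no two consecutive elements of the list consisting of `κ`, the marked vertices, and `e` serve the
port pair `p`; the length of the walk is `pot e - pot u + 2 * c`. -/
inductive Run (G : Gadget I J V) (p : J) (e : V) : V → V → ℕ → ℕ → Prop
  | done {κ} : ¬ G.serve κ e p → Run G p e κ e 0 0
  | mark {κ u m c} : ¬ G.serve κ u p → Run G p e u u m c → Run G p e κ u (m + 1) c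
  | fwd {κ u v m c} : G.adj u v → Run G p e κ v m c → Run G p e κ u m c
  | bwd {κ u v m c} : G.adj v u → Run G p e κ v m c →
      Run G p e κ u m (c + (G.pot u - G.pot v))

/-- A trade-off between the number of marked vertices and the excess length of a run with at least
`m₀` marked vertices. -/
def HopBound (G : Gadget I J V) (m₀ M S : ℕ) : Prop :=
  ∀ p m c, G.Run p (G.out (G.tgt p)) (G.inp (G.src p)) (G.inp (G.src p)) m c → m₀ ≤ m →
    M * S ≤ m * S + M * c

/-- The one-vertex gadget. -/
def point (I : Type) : Gadget I (I × I) Unit where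
  adj _ _ := False
  pot _ := 0
  inp _ := ()
  out _ := ()
  src := Prod.fst
  tgt := Prod.snd
  serve _ _ _ := False
  len := 0
  pot_lt h := h.elim
  pot_inp _ := rfl
  pot_out _ := rfl
  pair_inj h₁ h₂ := Prod.ext h₁ h₂
  serve_unique h := h.elim
  not_serve_self _ _ h := h
  not_serve_adj _ _ h := h
  not_serve_adj_symm _ _ h := h
  reach _ := .refl

/-- The unmarked run has no excess either, so the base case needs the threshold 1; substitution
later removes it. -/
theorem hopBound_point (I : Type) : (point I).HopBound 1 1 1 := by
  intro p m c _ hm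
  omega

end Gadget

/-! ### Average-free families -/

/-- No element of the range of `g` is a nontrivial average of `h` elements of the range. -/
def AverageFree {I A : Type} [AddCommGroup A] (h : ℕ) (g : I → A) : Prop :=
  ∀ (a : I) (l : List I), l.length = h → (l.map g).sum = h • g a → ∀ c ∈ l, c = a

namespace AverageFree

variable {I A : Type} [AddCommGroup A] {h : ℕ} {g : I → A}

/-- Otherwise `t` copies of `a` and `h - t` copies of `b` would average nontrivially to `b`. -/
theorem smul_cancel (hg : AverageFree h g) {t : ℕ} (ht : 1 ≤ t) (hth : t ≤ h) {a b : I}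
    (hab : t • g a = t • g b) : a = b := by
  refine hg b (List.replicate t a ++ List.replicate (h - t) b) (by simp; omega) ?_ a
    (by simp; omega)
  simp only [List.map_append, List.map_replicate, List.sum_append, List.sum_replicate, hab]
  rw [← add_smul, Nat.add_sub_cancel' hth]

theorem injective (hg : AverageFree h g) (hh : 1 ≤ h) : Function.Injective g := fun a b hab =>
  hg.smul_cancel le_rfl hh (by rw [hab])

/-- An arithmetic progression with difference in the range of `g` is determined by two terms. -/
theorem progression_unique (hg : AverageFree h g) {i j : ℕ} (hij : i < j) (hjh : j ≤ i + h)
    {a b : I} {x y X Y : A} (h1 : X = x + i • g a) (h2 : Y = x + j • g a)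
    (h3 : X = y + i • g b) (h4 : Y = y + j • g b) : a = b := by
  refine hg.smul_cancel (t := j - i) (by omega) (by omega) ?_
  obtain ⟨t, rfl⟩ := Nat.exists_eq_add_of_lt hij
  have e : i + t + 1 - i = t + 1 := by omega
  rw [e]
  have h5 : Y = X + (t + 1) • g a := by rw [h2, h1, add_assoc i, add_smul i, add_assoc]
  have h6 : Y = X + (t + 1) • g b := by rw [h4, h3, add_assoc i, add_smul i, add_assoc]
  exact add_left_cancel (h5.symm.trans h6)

end AverageFree

/-! ### The substitution product -/

namespace Gadget

variable {I J V A : Type} [AddCommGroup A]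

/-- The vertices of the substitution product. -/
abbrev SubstVertex (h : ℕ) (A V : Type) : Type :=
  (Fin (h + 1) × A × A) ⊕ (Fin h × A × A × V)

variable (G : Gadget I J V) (h W : ℕ) (g : I → A)

/-- Edges of the substitution product. -/
inductive SubstAdj : SubstVertex h A V → SubstVertex h A V → Prop
  | inner (i x y u v) : G.adj u v → SubstAdj (.inr (i, x, y, u)) (.inr (i, x, y, v))
  | enter (i x y a) : SubstAdj (.inl (i.castSucc, x, y)) (.inr (i, x + g a, y, G.inp a))
  | leave (i x y b) : SubstAdj (.inr (i, x, y, G.out b)) (.inl (i.succ, x, y + g b))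

/-- The potential of the substitution product. -/
def substPot : SubstVertex h A V → ℕ
  | .inl (i, _, _) => i * (2 * W + G.len)
  | .inr (i, _, _, u) => i * (2 * W + G.len) + W + G.pot u

/-- The vertex lies in a part of the substitution product that the canonical path of `p` meets. -/
def OnPath (p : A × A × J) : SubstVertex h A V → Prop
  | .inl (i, x, y) =>
      x = p.1 + (i : ℕ) • g (G.src p.2.2) ∧ y = p.2.1 + (i : ℕ) • g (G.tgt p.2.2)
  | .inr (i, x, y, _) =>
      x = p.1 + ((i : ℕ) + 1) • g (G.src p.2.2) ∧ y = p.2.1 + (i : ℕ) • g (G.tgt p.2.2)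

/-- The pair of vertices, both on the canonical path, is a shortcut. -/
def Skips (q : J) : SubstVertex h A V → SubstVertex h A V → Prop
  | .inl (i, _, _), .inl (j, _, _) => (i : ℕ) < j
  | .inl (i, _, _), .inr (j, _, _, v) =>
      (i : ℕ) < j ∨ (i : ℕ) = j ∧ G.serve (G.inp (G.src q)) v q
  | .inr (i, _, _, u), .inl (j, _, _) =>
      (i : ℕ) + 1 < j ∨ (i : ℕ) + 1 = j ∧ G.serve u (G.out (G.tgt q)) q
  | .inr (i, _, _, u), .inr (j, _, _, v) => (i : ℕ) < j ∨ (i : ℕ) = j ∧ G.serve u v q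

/-- The relation `serve` of the substitution product. -/
def SubstServe (u v : SubstVertex h A V) (p : A × A × J) : Prop :=
  G.OnPath h g p u ∧ G.OnPath h g p v ∧ G.Skips h p.2.2 u v

variable {G h g}

/-- A coordinate in which the two vertices differ in step count determines its port, by
`progression_unique`. When a coordinate has equal counts, both vertices belong to one round, and
uniqueness in the inner gadget determines what is missing. -/
theorem substServe_unique (hg : AverageFree h g) {u v : SubstVertex h A V} {p q : A × A × J}
    (hp : G.SubstServe h g u v p) (hq : G.SubstServe h g u v q) : p = q := by
  obtain ⟨p1, p2, p3⟩ := p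
  obtain ⟨q1, q2, q3⟩ := q
  obtain ⟨hpu, hpv, hps⟩ := hp
  obtain ⟨hqu, hqv, hqs⟩ := hq
  suffices p3 = q3 by
    subst this
    rcases u with ⟨i, x, y⟩ | ⟨i, x, y, u⟩
    all_goals
      have h1 := add_right_cancel (hpu.1.symm.trans hqu.1)
      have h2 := add_right_cancel (hpu.2.symm.trans hqu.2)
      simp only at h1 h2
      rw [h1, h2]
  rcases u with ⟨i, x, y⟩ | ⟨i, x, y, u⟩ <;> rcases v with ⟨j, x', y'⟩ | ⟨j, x', y', v⟩ <;>
    simp only [OnPath, Skips] at hpu hpv hps hqu hqv hqs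
  · have := j.2
    exact G.pair_inj
      (hg.progression_unique hps (by omega) hpu.1 hpv.1 hqu.1 hqv.1)
      (hg.progression_unique hps (by omega) hpu.2 hpv.2 hqu.2 hqv.2)
  · have := j.2
    have hs : G.src p3 = G.src q3 :=
      hg.progression_unique (by omega) (by omega) hpu.1 hpv.1 hqu.1 hqv.1
    rcases hps with hps | ⟨hij, hps⟩
    · exact G.pair_inj hs (hg.progression_unique hps (by omega) hpu.2 hpv.2 hqu.2 hqv.2)
    · rcases hqs with hqs | ⟨_, hqs⟩
      · omega
      · rw [hs] at hps
        exact G.serve_unique hps hqs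
  · have := j.2
    have hs : G.tgt p3 = G.tgt q3 :=
      hg.progression_unique (by omega) (by omega) hpu.2 hpv.2 hqu.2 hqv.2
    rcases hps with hps | ⟨hij, hps⟩
    · exact G.pair_inj (hg.progression_unique hps (by omega) hpu.1 hpv.1 hqu.1 hqv.1) hs
    · rcases hqs with hqs | ⟨_, hqs⟩
      · omega
      · rw [hs] at hps
        exact G.serve_unique hps hqs
  · have := j.2
    rcases hps with hps | ⟨hij, hps⟩
    · exact G.pair_inj
        (hg.progression_unique (by omega) (by omega) hpu.1 hpv.1 hqu.1 hqv.1)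
        (hg.progression_unique hps (by omega) hpu.2 hpv.2 hqu.2 hqv.2)
    · rcases hqs with hqs | ⟨_, hqs⟩
      · omega
      · exact G.serve_unique hps hqs

variable (G) in
/-- A copy of `G` is substituted for the middle vertex of every two-edge path of a layered graph
whose steps are the elements of an average-free family. -/
def subst {h W : ℕ} {g : I → A} (hg : AverageFree h g) (hh : 1 ≤ h) (hW : 1 ≤ W) :
    Gadget (A × A) (A × A × J) (SubstVertex h A V) where
  adj := G.SubstAdj h g
  pot := G.substPot h W
  inp a := .inl (0, a)
  out a := .inl (Fin.last h, a)
  src p := (p.1, p.2.1)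
  tgt p := (p.1 + h • g (G.src p.2.2), p.2.1 + h • g (G.tgt p.2.2))
  serve := G.SubstServe h g
  len := h * (2 * W + G.len)
  pot_lt := by
    rintro _ _ (⟨i, x, y, u, v, huv⟩ | ⟨i, x, y, a⟩ | ⟨i, x, y, b⟩)
    · have := G.pot_lt huv
      simpa [substPot] using this
    · simp [substPot]
      omega
    · simp [substPot, G.pot_out, add_mul]
      omega
  pot_inp a := by simp [substPot]
  pot_out b := by simp [substPot]
  pair_inj := by
    rintro ⟨p1, p2, p3⟩ ⟨q1, q2, q3⟩ hs ht
    simp only [Prod.mk.injEq] at hs ht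
    obtain ⟨rfl, rfl⟩ := hs
    rw [G.pair_inj (hg.smul_cancel hh le_rfl (add_left_cancel ht.1))
      (hg.smul_cancel hh le_rfl (add_left_cancel ht.2))]
  serve_unique := substServe_unique hg
  not_serve_self := by
    rintro (⟨i, x, y⟩ | ⟨i, x, y, u⟩) p ⟨-, -, hs⟩
    · simp [Skips] at hs
    · simp [Skips, G.not_serve_self] at hs
  not_serve_adj := by
    rintro _ _ (⟨i, x, y, u, v, huv⟩ | ⟨i, x, y, a⟩ | ⟨i, x, y, b⟩) p ⟨h1, h2, hs⟩
    · simp [Skips, G.not_serve_adj huv] at hs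
    -- With both ends on the canonical path, the edge must enter at the canonical port, so a
    -- shortcut would be a port serving itself.
    · have : g a = g (G.src p.2.2) := by
        have := h2.1.symm.trans (congrArg (· + g a) h1.1)
        simpa [add_smul, add_assoc] using this.symm
      obtain rfl := hg.injective hh this
      simp [Skips, G.not_serve_self] at hs
    · have : g b = g (G.tgt p.2.2) := by
        have := h2.2.symm.trans (congrArg (· + g b) h1.2)
        simpa [add_smul, add_assoc] using this.symm
      obtain rfl := hg.injective hh this
      simp [Skips, G.not_serve_self] at hs
  not_serve_adj_symm := by
    rintro _ _ (⟨i, x, y, u, v, huv⟩ | ⟨i, x, y, a⟩ | ⟨i, x, y, b⟩) p ⟨h1, h2, hs⟩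
    · simp [Skips, G.not_serve_adj_symm huv] at hs
    · simp [Skips] at hs
    · simp [Skips] at hs
  reach := by
    rintro ⟨x, y, p⟩
    suffices ∀ i : Fin (h + 1), Relation.ReflTransGen (G.SubstAdj h g) (.inl (0, x, y))
        (.inl (i, x + (i : ℕ) • g (G.src p), y + (i : ℕ) • g (G.tgt p))) by
      simpa using this (Fin.last h)
    intro i
    induction i using Fin.induction with
    | zero => simpa using Relation.ReflTransGen.refl
    | succ i ih =>
      refine ((ih.tail (.enter i _ _ (G.src p))).trans
        (Relation.ReflTransGen.lift (fun u => Sum.inr (i, x + (i : ℕ) • g (G.src p) + g (G.src p),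
          y + (i : ℕ) • g (G.tgt p), u)) (fun u v huv => .inner _ _ _ _ _ huv) _ _
          (G.reach p))).tail ?_
      have := SubstAdj.leave (G := G) (g := g) i (x + (i : ℕ) • g (G.src p) + g (G.src p))
        (y + (i : ℕ) • g (G.tgt p)) (G.tgt p)
      simpa [add_smul, add_assoc] using this

end Gadget

/-! ### Runs in the substitution product -/

namespace Gadget

variable {I J V A : Type} [AddCommGroup A] {G : Gadget I J V} {h W : ℕ} {g : I → A}

/-- The number of steps in the first coordinate that lead from the first layer to a vertex. -/
def xSteps : SubstVertex h A V → ℕ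
  | .inl (i, _, _) => i
  | .inr (i, _, _, _) => i + 1

/-- The number of steps in the second coordinate that lead from the first layer to a vertex. -/
def ySteps : SubstVertex h A V → ℕ
  | .inl (i, _, _) => i
  | .inr (i, _, _, _) => i

/-- The coordinates of a vertex of the substitution product. -/
def coords : SubstVertex h A V → A × A
  | .inl (_, x, y) => (x, y)
  | .inr (_, x, y, _) => (x, y)

variable (g) in
/-- The vertex can be reached from the first-layer vertex with coordinates `z` as far as the
numbers of steps are concerned. -/
def StepsFrom (z : A × A) (v : SubstVertex h A V) : Prop :=
  ∃ l l' : List I, l.length = xSteps v ∧ l'.length = ySteps v ∧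
    (coords v).1 = z.1 + (l.map g).sum ∧ (coords v).2 = z.2 + (l'.map g).sum

theorem StepsFrom.adj {z : A × A} {u v : SubstVertex h A V} (hu : StepsFrom g z u)
    (huv : G.SubstAdj h g u v) : StepsFrom g z v := by
  obtain ⟨l, l', h1, h2, h3, h4⟩ := hu
  rcases huv with ⟨i, x, y, u, v, huv⟩ | ⟨i, x, y, a⟩ | ⟨i, x, y, b⟩
  · exact ⟨l, l', h1, h2, h3, h4⟩
  · refine ⟨l ++ [a], l', by simpa [xSteps] using h1, h2, ?_, h4⟩
    simp only [coords] at h3 ⊢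
    simp [h3, add_assoc]
  · refine ⟨l, l' ++ [b], h1, by simpa [ySteps] using h2, h3, ?_⟩
    simp only [coords] at h4 ⊢
    simp [h4, add_assoc]

variable (hg : AverageFree h g) (hh : 1 ≤ h) (hW : 1 ≤ W)

/-- Crossing a connecting edge backward costs at least `W`, so with `c < W` these edges are used
only forward and the number of remaining steps is forced. -/
theorem exists_steps_of_run {p : A × A × J} {z : A × A} {κ u : SubstVertex h A V} {m c : ℕ}
    (r : (G.subst hg hh hW).Run p (.inl (Fin.last h, z)) κ u m c) (hc : c < W) :
    ∃ l l' : List I, l.length + xSteps u = h ∧ l'.length + ySteps u = h ∧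
      z.1 = (coords u).1 + (l.map g).sum ∧ z.2 = (coords u).2 + (l'.map g).sum := by
  induction r with
  | done _ => exact ⟨[], [], by simp [xSteps], by simp [ySteps], by simp [coords],
      by simp [coords]⟩
  | mark _ _ ih => exact ih hc
  | fwd huv _ ih =>
    obtain ⟨l, l', h1, h2, h3, h4⟩ := ih hc
    rcases huv with ⟨i, x, y, u, v, huv⟩ | ⟨i, x, y, a⟩ | ⟨i, x, y, b⟩
    · exact ⟨l, l', h1, h2, h3, h4⟩
    · refine ⟨a :: l, l', ?_, h2, ?_, h4⟩
      · simp only [xSteps, List.length_cons, Fin.val_castSucc] at h1 ⊢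
        omega
      · simp only [coords] at h3 ⊢
        simp [h3, add_assoc]
    · refine ⟨l, b :: l', h1, ?_, h3, ?_⟩
      · simp only [ySteps, List.length_cons, Fin.val_succ] at h2 ⊢
        omega
      · simp only [coords] at h4 ⊢
        simp [h4, add_assoc]
  | bwd huv _ ih =>
    obtain ⟨l, l', h1, h2, h3, h4⟩ := ih (by omega)
    rcases huv with ⟨i, x, y, u, v, huv⟩ | ⟨i, x, y, a⟩ | ⟨i, x, y, b⟩
    · exact ⟨l, l', h1, h2, h3, h4⟩
    · simp [subst, substPot, G.pot_inp] at hc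
    · simp [subst, substPot, G.pot_out, add_mul] at hc
      omega

/-- The steps before and after `u` are `h` in number in each coordinate and sum to `h` times one
element, so average-freeness makes them all equal. -/
theorem onPath_of_run {p : A × A × J} {κ u : SubstVertex h A V} {m c : ℕ}
    (r : (G.subst hg hh hW).Run p ((G.subst hg hh hW).out ((G.subst hg hh hW).tgt p)) κ u m c)
    (hc : c < W) (hu : StepsFrom g (p.1, p.2.1) u) : G.OnPath h g p u := by
  obtain ⟨l₁, l₁', h1, h2, h3, h4⟩ := exists_steps_of_run hg hh hW r hc
  obtain ⟨l₂, l₂', k1, k2, k3, k4⟩ := hu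
  rw [k3] at h3
  rw [k4] at h4
  simp only [subst, add_assoc] at h3 h4
  replace h3 := add_left_cancel h3
  replace h4 := add_left_cancel h4
  have e1 : l₂ = List.replicate l₂.length (G.src p.2.2) := List.eq_replicate_of_mem fun c hc =>
    hg _ (l₂ ++ l₁) (by simp; omega) (by simp [h3]) c (by simp [hc])
  have e2 : l₂' = List.replicate l₂'.length (G.tgt p.2.2) := List.eq_replicate_of_mem fun c hc =>
    hg _ (l₂' ++ l₁') (by simp; omega) (by simp [h4]) c (by simp [hc])
  rw [e1, k1, List.map_replicate, List.sum_replicate] at k3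
  rw [e2, k2, List.map_replicate, List.sum_replicate] at k4
  rcases u with ⟨i, x, y⟩ | ⟨i, x, y, u⟩ <;> exact ⟨k3, k4⟩

/-- The layer of `κ` is at most the layer of `u`. -/
def NotAfter : SubstVertex h A V → SubstVertex h A V → Prop
  | .inl (k, _, _), .inl (i, _, _) => (k : ℕ) ≤ i
  | .inr (k, _, _, _), .inl (i, _, _) => (k : ℕ) < i
  | .inl (k, _, _), .inr (i, _, _, _) => (k : ℕ) ≤ i
  | .inr (k, _, _, _), .inr (i, _, _, _) => (k : ℕ) ≤ i

variable (G) in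
/-- What a run from `u` to the end of the canonical path of `q`, with last marked vertex `κ` and
few backward edges, looks like. -/
def Splits (M S : ℕ) (q : J) : SubstVertex h A V → SubstVertex h A V → ℕ → ℕ → Prop
  | .inl (k, _, _), .inl (i, _, _), m, c => (k : ℕ) = i ∧ (h - i) * (M * S) ≤ m * S + M * c
  | .inr (k, _, _, κ), .inl (i, _, _), m, c =>
      ((k : ℕ) + 1 = i ∧ ¬ G.serve κ (G.out (G.tgt q)) q) ∧ (h - i) * (M * S) ≤ m * S + M * c
  | .inl (k, _, _), .inr (i, _, _, u), m, c => (k : ℕ) = i ∧ ∃ n m' c₁ c', m = n + m' ∧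
      c = c₁ + c' ∧ 1 ≤ n ∧ G.Run q (G.out (G.tgt q)) (G.inp (G.src q)) u n c₁ ∧
      (h - i - 1) * (M * S) ≤ m' * S + M * c'
  | .inr (k, _, _, κ), .inr (i, _, _, u), m, c => (k : ℕ) = i ∧ ∃ n m' c₁ c', m = n + m' ∧
      c = c₁ + c' ∧ G.Run q (G.out (G.tgt q)) κ u n c₁ ∧
      (h - i - 1) * (M * S) ≤ m' * S + M * c'

theorem notAfter_self {A V : Type} (u : SubstVertex h A V) : NotAfter u u := by
  rcases u with ⟨i, x, y⟩ | ⟨i, x, y, u⟩ <;> exact le_rfl (α := ℕ)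

/-- Induction from the end of the run. A mark at a layer vertex acts as one at the input port of the
next copy and at the output port of the previous one, so the part of the run inside a copy is itself
a run of the inner gadget. -/
theorem splits_of_run {M S : ℕ} (hb : G.HopBound 1 M S) {p : A × A × J}
    {κ u : SubstVertex h A V} {m c : ℕ}
    (r : (G.subst hg hh hW).Run p ((G.subst hg hh hW).out ((G.subst hg hh hW).tgt p)) κ u m c)
    (hc : c < W) (hu : StepsFrom g (p.1, p.2.1) u) (hκ : G.OnPath h g p κ) (hκu : NotAfter κ u) :
    G.Splits M S p.2.2 κ u m c := by
  have hon := onPath_of_run hg hh hW r hc hu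
  induction r with
  | @done κ hs =>
    replace hs : ¬ G.Skips h p.2.2 κ _ := fun h => hs ⟨hκ, hon, h⟩
    rcases κ with ⟨k, x, y⟩ | ⟨k, x, y, κ⟩
    · have hs : ¬ (k : ℕ) < Fin.last h := hs
      refine ⟨le_antisymm hκu (not_lt.1 hs), by simp⟩
    · have hs : ¬ ((k : ℕ) + 1 < Fin.last h ∨ (k : ℕ) + 1 = Fin.last h ∧ _) := hs
      have h' : (k : ℕ) < Fin.last h := hκu
      have h'' : (k : ℕ) + 1 = Fin.last h := by omega
      exact ⟨⟨h'', fun h => hs (.inr ⟨h'', h⟩)⟩, by simp⟩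
  | @mark κ u m c hs r ih =>
    replace hs : ¬ G.Skips h p.2.2 κ u := fun h => hs ⟨hκ, hon, h⟩
    have ih := ih hc hu hon (notAfter_self u) hon
    rcases u with ⟨i, x, y⟩ | ⟨i, x, y, u⟩
    -- Marks at layer vertices are not needed for the count and are given away.
    · have ih' : (h - i) * (M * S) ≤ (m + 1) * S + M * c :=
        ih.2.trans (by gcongr; omega)
      rcases κ with ⟨k, x', y'⟩ | ⟨k, x', y', κ⟩
      · have hs : ¬ (k : ℕ) < i := hs
        exact ⟨le_antisymm hκu (not_lt.1 hs), ih'⟩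
      · have hs : ¬ ((k : ℕ) + 1 < i ∨ (k : ℕ) + 1 = i ∧ _) := hs
        have h' : (k : ℕ) < i := hκu
        have h'' : (k : ℕ) + 1 = i := by omega
        exact ⟨⟨h'', fun h => hs (.inr ⟨h'', h⟩)⟩, ih'⟩
    · obtain ⟨-, n, m', c₁, c', rfl, rfl, hr, hrest⟩ := ih
      rcases κ with ⟨k, x', y'⟩ | ⟨k, x', y', κ⟩
      · have hs : ¬ ((k : ℕ) < i ∨ (k : ℕ) = i ∧ _) := hs
        have h' : (k : ℕ) ≤ i := hκu
        have h'' : (k : ℕ) = i := by omega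
        exact ⟨h'', n + 1, m', c₁, c', by omega, rfl, by omega,
          .mark (fun h => hs (.inr ⟨h'', h⟩)) hr, hrest⟩
      · have hs : ¬ ((k : ℕ) < i ∨ (k : ℕ) = i ∧ _) := hs
        have h' : (k : ℕ) ≤ i := hκu
        have h'' : (k : ℕ) = i := by omega
        exact ⟨h'', n + 1, m', c₁, c', by omega, rfl,
          .mark (fun h => hs (.inr ⟨h'', h⟩)) hr, hrest⟩
  | @fwd κ u v m c huv r ih =>
    have hv := hu.adj huv
    have hon' := onPath_of_run hg hh hW r hc hv
    rcases huv with ⟨i, x, y, u, v, huv⟩ | ⟨i, x, y, a⟩ | ⟨i, x, y, b⟩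
    · have ih := ih hc hv hκ
      rcases κ with ⟨k, x', y'⟩ | ⟨k, x', y', κ⟩
      · obtain ⟨hk, n, m', c₁, c', h1, h2, h3, hr, hrest⟩ := ih hκu hon'
        exact ⟨hk, n, m', c₁, c', h1, h2, h3, .fwd huv hr, hrest⟩
      · obtain ⟨hk, n, m', c₁, c', h1, h2, hr, hrest⟩ := ih hκu hon'
        exact ⟨hk, n, m', c₁, c', h1, h2, .fwd huv hr, hrest⟩
    · have ih := ih hc hv hκ
      obtain rfl : a = G.src p.2.2 := by
        refine hg.injective hh ?_
        have := hon'.1.symm.trans (congrArg (· + g a) hon.1)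
        simpa [add_smul, add_assoc] using this.symm
      rcases κ with ⟨k, x', y'⟩ | ⟨k, x', y', κ⟩
      · obtain ⟨hk, n, m', c₁, c', rfl, rfl, h3, hr, hrest⟩ := ih hκu hon'
        -- The copy just entered contains a mark, so the inner hop bound applies and adds one `M *
        -- S` to the later copies.
        have hb' := hb _ _ _ hr h3
        refine ⟨hk, ?_⟩
        have := i.2
        obtain ⟨t, ht⟩ : ∃ t, h - (i : ℕ) = t + 1 := ⟨h - i - 1, by omega⟩
        rw [Fin.val_castSucc]
        rw [ht] at hrest ⊢
        rw [Nat.add_sub_cancel] at hrest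
        linarith
      -- The layer vertex was passed unmarked: the next mark would complete a shortcut past it.
      · have h' : (k : ℕ) < i.castSucc := hκu
        obtain ⟨hk, -⟩ := ih (show (k : ℕ) ≤ i from h'.le) hon'
        exact absurd hk (ne_of_lt h')
    · have ih := ih hc hv hκ
      obtain rfl : b = G.tgt p.2.2 := by
        refine hg.injective hh ?_
        have := hon'.2.symm.trans (congrArg (· + g b) hon.2)
        simpa [add_smul, add_assoc] using this.symm
      rcases κ with ⟨k, x', y'⟩ | ⟨k, x', y', κ⟩
      -- The copy is left with no mark since a layer vertex at or before it, so the next mark would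
      -- complete a shortcut past the copy.
      · have h' : (k : ℕ) ≤ i := hκu
        obtain ⟨hk, -⟩ := ih (show (k : ℕ) ≤ i.succ by simp; omega) hon'
        simp only [Fin.val_succ] at hk
        omega
      · have h' : (k : ℕ) ≤ i := hκu
        obtain ⟨⟨hk, hs⟩, hrest⟩ := ih (show (k : ℕ) < i.succ by simp; omega) hon'
        rw [Fin.val_succ] at hk hrest
        exact ⟨by omega, 0, m, 0, c, by omega, by omega, .done hs, hrest⟩
  | @bwd κ u v m c huv r ih =>
    rcases huv with ⟨i, x, y, v, u, huv⟩ | ⟨i, x, y, a⟩ | ⟨i, x, y, b⟩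
    · have hv : StepsFrom g (p.1, p.2.1) (.inr (i, x, y, v) : SubstVertex h A V) := hu
      have hon' := onPath_of_run hg hh hW r (by omega) hv
      have hpot : (G.subst hg hh hW).pot (.inr (i, x, y, u)) -
          (G.subst hg hh hW).pot (.inr (i, x, y, v)) = G.pot u - G.pot v := by
        simp only [subst, substPot]
        omega
      rw [hpot]
      have ih := ih (by omega) hv hκ
      rcases κ with ⟨k, x', y'⟩ | ⟨k, x', y', κ⟩
      · obtain ⟨hk, n, m', c₁, c', h1, h2, h3, hr, hrest⟩ := ih hκu hon'
        exact ⟨hk, n, m', _, c', h1, by omega, h3, .bwd huv hr, hrest⟩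
      · obtain ⟨hk, n, m', c₁, c', h1, h2, hr, hrest⟩ := ih hκu hon'
        exact ⟨hk, n, m', _, c', h1, by omega, .bwd huv hr, hrest⟩
    · simp [subst, substPot, G.pot_inp] at hc
    · simp [subst, substPot, G.pot_out, add_mul] at hc
      omega

/-- The hop bound of a substitution product holds for all runs, with or without marks. -/
theorem subst_hopBound {M S : ℕ} (hb : G.HopBound 1 M S) (hS : W = h * S) (m₀ : ℕ) :
    (G.subst hg hh hW).HopBound m₀ (h * M) (h * S) := by
  intro p m c r _
  -- An excess of at least `W = h * S` already pays for the whole bound.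
  rcases lt_or_ge c W with hc | hc
  · have := (splits_of_run hg hh hW hb r hc ⟨[], [], rfl, rfl, by simp [coords, subst],
      by simp [coords, subst]⟩ ⟨by simp, by simp⟩ (notAfter_self _)).2
    simp only [Fin.val_zero, Nat.sub_zero] at this
    calc h * M * (h * S) = h * (h * (M * S)) := by ring
      _ ≤ h * (m * S + M * c) := by gcongr
      _ = _ := by ring
  · calc h * M * (h * S) = h * M * W := by rw [hS]
      _ ≤ h * M * c := by gcongr
      _ ≤ _ := by omega

end Gadget

/-! ### Behrend's construction -/

theorem AverageFree.comp {I I' A : Type} [AddCommGroup A] {h : ℕ} {g : I → A}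
    (hg : AverageFree h g) {f : I' → I} (hf : Function.Injective f) : AverageFree h (g ∘ f) := by
  intro a l hl hs c hc
  refine hf (hg (f a) (l.map f) (by simpa using hl) (by simpa using hs) (f c) ?_)
  exact List.mem_map_of_mem hc

/-- The lattice points of a cube on a sphere, modulo a number so large that sums of `h` points do
not wrap around, are average-free. -/
theorem averageFree_sphere (h r m k : ℕ) :
    AverageFree h (fun (v : Behrend.sphere m r k) (i : Fin m) =>
      ((v.1 i : ℕ) : ZMod (h * r))) := by
  intro v l hl hs c hc
  have hmem : ∀ u : Behrend.sphere m r k, (∀ i, u.1 i < r) ∧ ∑ i, u.1 i ^ 2 = k := by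
    intro u
    have := u.2
    simpa [Behrend.sphere, Behrend.mem_box] using this
  have hh : 0 < h := hl ▸ List.length_pos_of_mem hc
  have hcoord : ∀ i, ∑ j : Fin l.length, l[j].1 i = h * v.1 i := by
    intro i
    have h1 := congrFun hs i
    rw [← Fin.sum_univ_fun_getElem] at h1
    simp only [Finset.sum_apply, Pi.smul_apply, nsmul_eq_mul] at h1
    have h2 : ((∑ j : Fin l.length, l[j].1 i : ℕ) : ZMod (h * r)) = ((h * v.1 i : ℕ) :) := by
      push_cast
      exact h1
    rw [ZMod.natCast_eq_natCast_iff', Nat.mod_eq_of_lt, Nat.mod_eq_of_lt] at h2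
    · exact h2
    · exact Nat.mul_lt_mul_of_pos_left ((hmem v).1 i) hh
    · calc ∑ j : Fin l.length, l[j].1 i < ∑ j : Fin l.length, r :=
            Finset.sum_lt_sum_of_nonempty ⟨⟨0, by omega⟩, Finset.mem_univ _⟩
              fun j _ => (hmem _).1 i
        _ = h * r := by simp [hl]
  -- Strict convexity of the sphere: expanding the squared distances to the mean `v` gives `h * k -
  -- 2 * h * k + h * k`.
  have hzero : ∑ j : Fin l.length, ∑ i, ((l[j].1 i : ℤ) - v.1 i) ^ 2 = 0 := by
    have e1 : ∑ j : Fin l.length, ∑ i, ((l[j].1 i : ℤ)) ^ 2 = h * k := by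
      have : ∀ j : Fin l.length, ∑ i, ((l[j].1 i : ℤ)) ^ 2 = k := fun j => by
        exact_mod_cast (hmem l[j]).2
      rw [Finset.sum_congr rfl fun j _ => this j]
      simp [hl]
    have e2 : ∑ j : Fin l.length, ∑ i, ((l[j].1 i : ℤ)) * v.1 i = h * k := by
      rw [Finset.sum_comm]
      have : ∀ i, ∑ j : Fin l.length, (l[j].1 i : ℤ) * v.1 i = h * (v.1 i : ℤ) ^ 2 := by
        intro i
        rw [← Finset.sum_mul]
        have := hcoord i
        zify at this
        rw [this]
        ring
      simp only [this]
      rw [← Finset.mul_sum]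
      congr 1
      exact_mod_cast (hmem v).2
    have e3 : ∑ j : Fin l.length, ∑ i, ((v.1 i : ℤ)) ^ 2 = h * k := by
      have : ∑ i, ((v.1 i : ℤ)) ^ 2 = k := by exact_mod_cast (hmem v).2
      simp [this, hl]
    calc _ = ∑ j : Fin l.length, ∑ i, ((l[j].1 i : ℤ)) ^ 2
          - 2 * ∑ j : Fin l.length, ∑ i, ((l[j].1 i : ℤ)) * v.1 i
          + ∑ j : Fin l.length, ∑ i, ((v.1 i : ℤ)) ^ 2 := by
            simp only [Finset.mul_sum, ← Finset.sum_sub_distrib, ← Finset.sum_add_distrib]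
            refine Finset.sum_congr rfl fun j _ => Finset.sum_congr rfl fun i _ => ?_
            ring
      _ = 0 := by rw [e1, e2, e3]; ring
  rw [Finset.sum_eq_zero_iff_of_nonneg fun j _ => Finset.sum_nonneg fun i _ => sq_nonneg _] at hzero
  obtain ⟨j, hj, rfl⟩ := List.mem_iff_getElem.1 hc
  have := hzero ⟨j, hj⟩ (Finset.mem_univ _)
  rw [Finset.sum_eq_zero_iff_of_nonneg fun i _ => sq_nonneg _] at this
  refine Subtype.ext (funext fun i => ?_)
  have := this i (Finset.mem_univ _)
  rw [sq_eq_zero_iff, sub_eq_zero] at this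
  exact_mod_cast this

/-- Every finite type has an average-free map into an abelian group of nearly the same size. -/
theorem exists_averageFree {η : ℝ} (hη : 0 < η) (hη1 : η ≤ 1) :
    ∃ C : ℕ, 1 ≤ C ∧ ∀ (I : Type) [Finite I] [Nonempty I] (h : ℕ), 1 ≤ h →
      ∃ (m q : ℕ) (g : I → Fin m → ZMod q), 1 ≤ q ∧ AverageFree h g ∧
        (q : ℝ) ^ m ≤ ((C : ℝ) * h) ^ C * (Nat.card I : ℝ) ^ (1 + η) := by
  -- In dimension `M + 2`, some sphere has at least `r ^ M / (M + 2)` points, while the group has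
  -- `(h * r) ^ (M + 2)` elements: the exponent loss is `2 / M < η`.
  obtain ⟨M, hM⟩ := exists_nat_gt (2 / η)
  have hM0 : (0 : ℝ) < M := lt_trans (by positivity) hM
  have hM1 : 1 ≤ M := by exact_mod_cast hM0
  refine ⟨M + 4 + M, by omega, fun I _ _ h hh => ?_⟩
  set s : ℝ := (Nat.card I : ℝ) with hs
  have hs1 : 1 ≤ s := by rw [hs]; exact_mod_cast Nat.card_pos (α := I)
  have hms : 1 ≤ ((M + 2 : ℕ) : ℝ) * s :=
    one_le_mul_of_one_le_of_one_le (by exact_mod_cast (by omega : 1 ≤ M + 2)) hs1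
  set z : ℝ := (((M + 2 : ℕ) : ℝ) * s) ^ (1 / (M : ℝ)) with hz
  have hz1 : 1 ≤ z := Real.one_le_rpow hms (by positivity)
  have hzM : z ^ M = ((M + 2 : ℕ) : ℝ) * s := by
    rw [hz, ← Real.rpow_natCast, ← Real.rpow_mul (by positivity), one_div_mul_cancel hM0.ne',
      Real.rpow_one]
  set r : ℕ := ⌈z⌉₊ with hr
  have hzr : z ≤ r := Nat.le_ceil z
  have hr1 : (1 : ℝ) ≤ r := hz1.trans hzr
  have hr2 : (r : ℝ) ≤ 2 * z := by
    have := (Nat.ceil_lt_add_one (by positivity : 0 ≤ z)).le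
    linarith
  obtain ⟨k, hk⟩ := Behrend.exists_large_sphere (M + 2) r
  have hcard : Nat.card I ≤ Nat.card (Behrend.sphere (M + 2) r k) := by
    have : s ≤ (Behrend.sphere (M + 2) r k).card := by
      refine le_trans ?_ hk
      push_cast
      rw [le_div_iff₀ (by positivity), pow_add]
      have : ((M : ℝ) + 2) * s ≤ (r : ℝ) ^ M := by
        have := pow_le_pow_left₀ (by positivity) hzr M
        rw [hzM] at this
        push_cast at this
        exact this
      nlinarith [sq_nonneg (r : ℝ)]
    rw [Nat.card_eq_fintype_card (α := Behrend.sphere (M + 2) r k), Fintype.card_coe]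
    rw [hs] at this
    exact_mod_cast this
  obtain ⟨f⟩ : Nonempty (I ↪ Behrend.sphere (M + 2) r k) := by
    have := Fintype.ofFinite I
    rw [Nat.card_eq_fintype_card, Nat.card_eq_fintype_card] at hcard
    exact Function.Embedding.nonempty_of_card_le hcard
  refine ⟨M + 2, h * r, _, Nat.mul_pos hh (by exact_mod_cast hr1),
    (averageFree_sphere h r (M + 2) k).comp f.injective, ?_⟩
  have hh1 : (1 : ℝ) ≤ h := by exact_mod_cast hh
  have hzm : z ^ (M + 2) ≤ ((M + 2 : ℕ) : ℝ) ^ 2 * s ^ (1 + η) := by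
    calc z ^ (M + 2) = (((M + 2 : ℕ) : ℝ) * s) ^ (1 + 2 / (M : ℝ)) := by
          rw [hz, ← Real.rpow_natCast, ← Real.rpow_mul (by positivity)]
          congr 1
          push_cast
          field_simp
      _ ≤ (((M + 2 : ℕ) : ℝ) * s) ^ (1 + η) := by
          refine Real.rpow_le_rpow_of_exponent_le hms ?_
          have : 2 / (M : ℝ) ≤ η := by
            rw [div_le_iff₀ hM0]
            rw [div_lt_iff₀ hη] at hM
            linarith
          linarith
      _ = ((M + 2 : ℕ) : ℝ) ^ (1 + η) * s ^ (1 + η) :=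
          Real.mul_rpow (by positivity) (by positivity)
      _ ≤ ((M + 2 : ℕ) : ℝ) ^ (2 : ℝ) * s ^ (1 + η) := by
          gcongr
          · exact_mod_cast (by omega : 1 ≤ M + 2)
          · linarith
      _ = _ := by norm_num
  have hb : (1 : ℝ) ≤ ((M + 4 + M : ℕ) : ℝ) * h :=
    one_le_mul_of_one_le_of_one_le (by exact_mod_cast (by omega : 1 ≤ M + 4 + M)) hh1
  calc ((h * r : ℕ) : ℝ) ^ (M + 2) = (h : ℝ) ^ (M + 2) * (r : ℝ) ^ (M + 2) := by
        push_cast; rw [mul_pow]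
    _ ≤ (h : ℝ) ^ (M + 2) * (2 * z) ^ (M + 2) := by gcongr
    _ = (2 * h) ^ (M + 2) * z ^ (M + 2) := by rw [mul_pow, mul_pow]; ring
    _ ≤ (2 * h) ^ (M + 2) * (((M + 2 : ℕ) : ℝ) ^ 2 * s ^ (1 + η)) := by gcongr
    _ = (2 * h) ^ (M + 2) * ((M + 2 : ℕ) : ℝ) ^ 2 * s ^ (1 + η) := by ring
    _ ≤ (((M + 4 + M : ℕ) : ℝ) * h) ^ (M + 2) *
        (((M + 4 + M : ℕ) : ℝ) * h) ^ 2 * s ^ (1 + η) := by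
        gcongr
        · exact_mod_cast (by omega : 2 ≤ M + 4 + M)
        · calc ((M + 2 : ℕ) : ℝ) ≤ ((M + 4 + M : ℕ) : ℝ) := by
                exact_mod_cast (by omega : M + 2 ≤ M + 4 + M)
            _ ≤ ((M + 4 + M : ℕ) : ℝ) * h := le_mul_of_one_le_right (by positivity) hh1
    _ = (((M + 4 + M : ℕ) : ℝ) * h) ^ (M + 4) * s ^ (1 + η) := by rw [← pow_add]
    _ ≤ _ := by
        exact mul_le_mul_of_nonneg_right (pow_le_pow_right₀ hb (by omega)) (by positivity)

/-! ### Sizes of the recursive gadgets -/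

namespace Gadget

/-- There are gadgets with many port pairs on few vertices that need many hops. -/
def HasFamily (m₀ k : ℕ) (η : ℝ) : Prop :=
  ∃ C : ℕ, 1 ≤ C ∧ ∀ X h : ℕ, 1 ≤ X → 1 ≤ h →
    ∃ (I J V : Type) (_ : Finite I) (_ : Finite J) (_ : Finite V) (G : Gadget I J V),
      G.HopBound m₀ (h ^ k) (h ^ k) ∧ G.len = 2 * k * h ^ (k + 1) ∧ 1 ≤ Nat.card V ∧
      X ^ 2 ^ k ≤ Nat.card I ∧ X ^ 2 ^ (k + 1) ≤ Nat.card J ∧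
      (Nat.card I : ℝ) ≤ ((C : ℝ) * h) ^ C * (X : ℝ) ^ ((2 : ℝ) ^ k + η) ∧
      (Nat.card V : ℝ) ≤ ((C : ℝ) * h) ^ C * (X : ℝ) ^ (2 * ((2 : ℝ) ^ k - 1) + η)

theorem hasFamily_zero {η : ℝ} (hη : 0 < η) : HasFamily 1 0 η := by
  refine ⟨1, le_rfl, fun X h hX hh => ⟨Fin X, Fin X × Fin X, Unit, inferInstance, inferInstance,
    inferInstance, point (Fin X), ?_, ?_, ?_, ?_, ?_, ?_, ?_⟩⟩
  · simpa using hopBound_point (Fin X)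
  · simp [point]
  · simp
  · simp
  · simp [sq]
  · have hX' : (1 : ℝ) ≤ X := by exact_mod_cast hX
    have hh' : (1 : ℝ) ≤ h := by exact_mod_cast hh
    have h1 : (X : ℝ) ≤ (X : ℝ) ^ (1 + η) := by
      conv_lhs => rw [← Real.rpow_one (X : ℝ)]
      exact Real.rpow_le_rpow_of_exponent_le hX' (by linarith)
    simp only [Nat.card_eq_fintype_card, Fintype.card_fin, Nat.cast_one, one_mul, pow_one, pow_zero]
    exact h1.trans (le_mul_of_one_le_left (by positivity) hh')
  · have hX' : (1 : ℝ) ≤ X := by exact_mod_cast hX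
    have hh' : (1 : ℝ) ≤ h := by exact_mod_cast hh
    have h1 : 1 ≤ (X : ℝ) ^ η := Real.one_le_rpow hX' hη.le
    simpa using one_le_mul_of_one_le_of_one_le hh' h1

/-- The average-free group has size about that of `I`, so one substitution squares the number of
ports and multiplies both port pairs and vertices by that square, up to the losses. -/
theorem HasFamily.succ {k m₀ : ℕ} {η : ℝ} (hη : 0 < η) (hη1 : η ≤ 1)
    (hk : HasFamily 1 k (η / 16)) : HasFamily m₀ (k + 1) η := by
  obtain ⟨C₁, hC₁, H⟩ := hk
  obtain ⟨C₂, hC₂, H₂⟩ := exists_averageFree (η := η / 2 ^ (k + 3)) (by positivity)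
    ((div_le_self hη.le (one_le_pow₀ (by norm_num))).trans hη1)
  -- Absorbs `3 * h * B₂ ^ 2 * B₁ ^ 5`: `B₂ ^ 2 * B₁ ^ 4` from the two group coordinates (the
  -- exponent of `B₁` in each rounded up to 2) and one more `B₁` from the inner vertices.
  refine ⟨3 + 2 * C₂ + 5 * C₁, by omega, fun X h hX hh => ?_⟩
  obtain ⟨I, J, V, _, _, _, G, hb, hlen, hV, hIge, hJge, hIle, hVle⟩ := H X h hX hh
  have hI1 : 1 ≤ Nat.card I := (Nat.one_le_pow _ _ hX).trans hIge
  have : Nonempty I := (Nat.card_pos_iff.1 hI1).1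
  obtain ⟨m, q, g, hq, hg, hA⟩ := H₂ I h hh
  have : NeZero q := ⟨by omega⟩
  have hW : 1 ≤ h * h ^ k := Nat.mul_pos hh (Nat.pow_pos hh)
  have hcardA : Nat.card (Fin m → ZMod q) = q ^ m := by simp
  have hIA : Nat.card I ≤ q ^ m := hcardA ▸ Nat.card_le_card_of_injective g (hg.injective hh)
  refine ⟨_, _, _, inferInstance, inferInstance, inferInstance, G.subst hg hh hW, ?_, ?_, ?_, ?_,
    ?_, ?_⟩
  · simpa only [pow_succ'] using subst_hopBound hg hh hW hb rfl m₀
  · simp only [subst, hlen]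
    ring
  · exact Nat.card_pos_iff.2 ⟨⟨.inl (0, 0, 0)⟩, inferInstance⟩
  · rw [Nat.card_prod, hcardA, pow_succ, pow_mul, sq]
    exact Nat.mul_le_mul (hIge.trans hIA) (hIge.trans hIA)
  · rw [Nat.card_prod, Nat.card_prod, hcardA, ← mul_assoc]
    calc X ^ 2 ^ (k + 1 + 1) = X ^ 2 ^ k * X ^ 2 ^ k * X ^ 2 ^ (k + 1) := by
          rw [← pow_add, ← pow_add]; congr 1; ring
      _ ≤ _ := Nat.mul_le_mul (Nat.mul_le_mul (hIge.trans hIA) (hIge.trans hIA)) hJge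
  set a : ℝ := (q : ℝ) ^ m with ha
  set B₁ : ℝ := ((C₁ : ℝ) * h) ^ C₁ with hB₁
  set B₂ : ℝ := ((C₂ : ℝ) * h) ^ C₂ with hB₂
  set K : ℝ := ((3 + 2 * C₂ + 5 * C₁ : ℕ) : ℝ) * h with hK
  have hh' : (1 : ℝ) ≤ h := by exact_mod_cast hh
  have hX' : (1 : ℝ) ≤ X := by exact_mod_cast hX
  have hX0 : (0 : ℝ) < X := by linarith
  have hB₁1 : 1 ≤ B₁ :=
    one_le_pow₀ (one_le_mul_of_one_le_of_one_le (by exact_mod_cast hC₁) hh')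
  have hB₂1 : 1 ≤ B₂ :=
    one_le_pow₀ (one_le_mul_of_one_le_of_one_le (by exact_mod_cast hC₂) hh')
  have hKB : 3 * h * (B₂ ^ 2 * B₁ ^ 5) ≤ K ^ (3 + 2 * C₂ + 5 * C₁) := by
    have hK1 : 1 ≤ K :=
      one_le_mul_of_one_le_of_one_le (by exact_mod_cast (by omega)) hh'
    have k1 : 3 * (h : ℝ) ≤ K := by
      rw [hK]; gcongr; exact_mod_cast (by omega : 3 ≤ 3 + 2 * C₂ + 5 * C₁)
    have k2 : (C₂ : ℝ) * h ≤ K := by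
      rw [hK]; gcongr; omega
    have k3 : (C₁ : ℝ) * h ≤ K := by
      rw [hK]; gcongr; omega
    calc 3 * h * (B₂ ^ 2 * B₁ ^ 5) ≤ K * ((K ^ C₂) ^ 2 * (K ^ C₁) ^ 5) := by
          rw [hB₁, hB₂]; gcongr
      _ = K ^ (1 + 2 * C₂ + 5 * C₁) := by ring
      _ ≤ _ := pow_le_pow_right₀ hK1 (by omega)
  have hA2 : a * a ≤ B₂ ^ 2 * B₁ ^ 4 * (X : ℝ) ^ ((2 : ℝ) ^ (k + 1) + η / 2) := by
    have hη2 : η / 2 ^ (k + 3) ≤ 1 :=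
      (div_le_self hη.le (one_le_pow₀ (by norm_num))).trans hη1
    have h1 : (Nat.card I : ℝ) ^ (1 + η / 2 ^ (k + 3)) ≤
        B₁ ^ 2 * (X : ℝ) ^ (((2 : ℝ) ^ k + η / 16) * (1 + η / 2 ^ (k + 3))) := by
      calc _ ≤ (B₁ * (X : ℝ) ^ ((2 : ℝ) ^ k + η / 16)) ^ (1 + η / 2 ^ (k + 3)) := by gcongr
        _ = B₁ ^ (1 + η / 2 ^ (k + 3)) *
            (X : ℝ) ^ (((2 : ℝ) ^ k + η / 16) * (1 + η / 2 ^ (k + 3))) := by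
          rw [Real.mul_rpow (by positivity) (by positivity), ← Real.rpow_mul hX0.le]
        _ ≤ _ := by
          refine mul_le_mul_of_nonneg_right ?_ (by positivity)
          rw [← Real.rpow_natCast B₁ 2]
          exact Real.rpow_le_rpow_of_exponent_le hB₁1 (by push_cast; linarith)
    calc a * a ≤ (B₂ * (B₁ ^ 2 * (X : ℝ) ^ (((2 : ℝ) ^ k + η / 16) * (1 + η / 2 ^ (k + 3))))) *
        (B₂ * (B₁ ^ 2 * (X : ℝ) ^ (((2 : ℝ) ^ k + η / 16) * (1 + η / 2 ^ (k + 3))))) := by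
          have := hA.trans (mul_le_mul_of_nonneg_left h1 (by positivity))
          gcongr
      _ = B₂ ^ 2 * B₁ ^ 4 * (X : ℝ) ^ (((2 : ℝ) ^ k + η / 16) * (1 + η / 2 ^ (k + 3)) +
          ((2 : ℝ) ^ k + η / 16) * (1 + η / 2 ^ (k + 3))) := by
          rw [Real.rpow_add hX0]; ring
      _ ≤ _ := by
          refine mul_le_mul_of_nonneg_left (Real.rpow_le_rpow_of_exponent_le hX' ?_) (by positivity)
          · have e1 : (2 : ℝ) ^ k * (η / 2 ^ (k + 3)) = η / 8 := by
              rw [pow_add]; field_simp; norm_num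
            have e2 : η / 16 * (η / 2 ^ (k + 3)) ≤ η / 16 :=
              mul_le_of_le_one_right (by positivity) hη2
            have e3 : (2 : ℝ) ^ (k + 1) = 2 * 2 ^ k := by ring
            nlinarith
  have hcardA' : (Nat.card (Fin m → ZMod q) : ℝ) = a := by rw [hcardA]; push_cast; rfl
  constructor
  · rw [Nat.card_prod, Nat.cast_mul, hcardA']
    refine hA2.trans ?_
    refine mul_le_mul ?_ (Real.rpow_le_rpow_of_exponent_le hX' (by linarith)) (by positivity)
      (by positivity)
    refine le_trans ?_ hKB
    have e1 : B₂ ^ 2 * B₁ ^ 4 ≤ B₂ ^ 2 * B₁ ^ 5 := by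
      refine mul_le_mul_of_nonneg_left (pow_le_pow_right₀ hB₁1 (by norm_num)) (by positivity)
    exact e1.trans (le_mul_of_one_le_left (by positivity) (by linarith))
  · have hcard : (Nat.card (SubstVertex h (Fin m → ZMod q) V) : ℝ) =
        (h + 1) * (a * a) + h * (a * a * Nat.card V) := by
      rw [Nat.card_sum, Nat.card_prod, Nat.card_prod, Nat.card_prod, Nat.card_prod, Nat.card_prod]
      push_cast
      rw [hcardA']
      simp only [Nat.card_eq_fintype_card, Fintype.card_fin]
      push_cast
      ring
    have hV' : (1 : ℝ) ≤ Nat.card V := by exact_mod_cast hV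
    have haa : 0 ≤ a * a := mul_self_nonneg a
    rw [hcard]
    calc (h + 1) * (a * a) + h * (a * a * Nat.card V)
        ≤ (h + h) * (a * a * Nat.card V) + h * (a * a * Nat.card V) := by
          have : a * a ≤ a * a * Nat.card V := le_mul_of_one_le_right haa hV'
          gcongr
      _ = 3 * h * (a * a * Nat.card V) := by ring
      _ ≤ 3 * h * ((B₂ ^ 2 * B₁ ^ 4 * (X : ℝ) ^ ((2 : ℝ) ^ (k + 1) + η / 2)) *
          (B₁ * (X : ℝ) ^ (2 * ((2 : ℝ) ^ k - 1) + η / 16))) := by gcongr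
      _ = 3 * h * (B₂ ^ 2 * B₁ ^ 5) * (X : ℝ) ^ ((2 : ℝ) ^ (k + 1) + η / 2 +
          (2 * ((2 : ℝ) ^ k - 1) + η / 16)) := by
          rw [Real.rpow_add hX0 _ (_ + _)]; ring
      _ ≤ _ := by
          refine mul_le_mul hKB (Real.rpow_le_rpow_of_exponent_le hX' ?_) (by positivity)
            (by positivity)
          rw [pow_succ]
          linarith

theorem hasFamily_one (k : ℕ) : ∀ {η : ℝ}, 0 < η → η ≤ 1 → HasFamily 1 k η := by
  induction k with
  | zero => exact fun hη _ => hasFamily_zero hη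
  | succ k ih => exact fun hη hη1 => (ih (by positivity) (by linarith)).succ hη hη1

/-- The outermost substitution lowers the threshold on marks from 1 to 0, which is why `k` is
positive. -/
theorem hasFamily {k : ℕ} (hk : 1 ≤ k) {η : ℝ} (hη : 0 < η) (hη1 : η ≤ 1) : HasFamily 0 k η := by
  obtain ⟨k, rfl⟩ := Nat.exists_eq_add_of_le' hk
  exact (hasFamily_one k (by positivity) (by linarith)).succ hη hη1

end Gadget

/-! ### From hopsets to runs -/

theorem walkLength_cons {V : Type*} {G : SimpleGraph V} (w : Sym2 V → ℝ≥0∞) {u v x : V}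
    (h : G.Adj u v) (p : G.Walk v x) : walkLength w (.cons h p) = w s(u, v) + walkLength w p := by
  simp [walkLength]

/-- The number of ordered pairs whose unordered pair lies in a finite set. -/
theorem card_orderedPairs_le {α : Type*} [Fintype α] [DecidableEq α] (H : Finset (Sym2 α)) :
    (Finset.univ.filter fun x : α × α => s(x.1, x.2) ∈ H).card ≤ 2 * H.card := by
  refine Finset.card_le_mul_card_image_of_maps_to (f := fun x : α × α => s(x.1, x.2))
    (fun x hx => (Finset.mem_filter.1 hx).2) 2 fun e _ => ?_
  induction e with
  | _ a b =>
    refine (Finset.card_le_card (t := {(a, b), (b, a)}) fun x hx => ?_).trans Finset.card_le_two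
    obtain ⟨x, y⟩ := x
    simpa using (Finset.mem_filter.1 hx).2

namespace Gadget

variable {I J V : Type} {n : ℕ} (G : Gadget I J V) (ι : V ↪ Fin n)

/-- The weighted graph on `Fin n` given by a gadget on a subset of the vertices. -/
noncomputable def toWeightedGraph : WeightedGraph (Fin n) where
  graph :=
    { Adj := fun x y => ∃ u v, ι u = x ∧ ι v = y ∧ (G.adj u v ∨ G.adj v u)
      symm := ⟨fun _ _ ⟨u, v, hu, hv, h⟩ => ⟨v, u, hv, hu, h.symm⟩⟩
      loopless := ⟨by
        rintro x ⟨u, v, hu, hv, h⟩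
        obtain rfl := ι.injective (hu.trans hv.symm)
        exact (h.elim G.pot_lt G.pot_lt).ne rfl⟩ }
  -- The default potential 0 is harmless: vertices outside the range of `ι` are isolated.
  weight := Sym2.lift ⟨fun x y => 
    |((Function.extend ι G.pot 0 x : ℕ) : ℝ) - (Function.extend ι G.pot 0 y : ℕ)|,
    fun _ _ => abs_sub_comm _ _⟩
  weight_pos := by
    intro e
    induction e with
    | _ x y =>
      rintro ⟨u, v, rfl, rfl, h⟩
      simp only [Sym2.lift_mk, ι.injective.extend_apply, abs_pos, sub_ne_zero, ne_eq, Nat.cast_inj]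
      exact h.elim (fun h => (G.pot_lt h).ne) fun h => (G.pot_lt h).ne'

variable {G ι}

theorem edgeLength_add_pot {u v : V} (h : G.adj u v) :
    (G.toWeightedGraph ι).edgeLength s(ι u, ι v) + G.pot u = G.pot v := by
  have hlt := G.pot_lt h
  simp only [WeightedGraph.edgeLength, toWeightedGraph, Sym2.lift_mk, ι.injective.extend_apply]
  rw [abs_sub_comm, ← Nat.cast_sub hlt.le, Nat.abs_cast, ENNReal.ofReal_natCast]
  exact_mod_cast Nat.sub_add_cancel hlt.le

theorem exists_walk_of_reach {u v : V} (h : Relation.ReflTransGen G.adj u v) :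
    ∃ q : (G.toWeightedGraph ι).graph.Walk (ι u) (ι v),
      walkLength (G.toWeightedGraph ι).edgeLength q + G.pot u = G.pot v := by
  induction h using Relation.ReflTransGen.head_induction_on with
  | refl => exact ⟨.nil, by simp [walkLength]⟩
  | head h _ ih =>
    obtain ⟨q, hq⟩ := ih
    have hadj : (G.toWeightedGraph ι).graph.Adj _ _ := ⟨_, _, rfl, rfl, .inl h⟩
    refine ⟨.cons hadj q, ?_⟩
    rw [walkLength_cons, add_right_comm, edgeLength_add_pot h, add_comm, hq]

theorem dist_port_le (p : J) :
    (G.toWeightedGraph ι).dist (ι (G.inp (G.src p))) (ι (G.out (G.tgt p))) ≤ G.len := by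
  obtain ⟨q, hq⟩ := exists_walk_of_reach (ι := ι) (G.reach p)
  rw [G.pot_inp, G.pot_out, Nat.cast_zero, add_zero] at hq
  exact (iInf_le _ q).trans hq.le

/-- A walk in the weighted graph can be prepended to a run. -/
theorem exists_prepend {x y : Fin n} (q : (G.toWeightedGraph ι).graph.Walk x y) :
    ∀ u, ι u = x → ∃ v, ι v = y ∧ ∃ c : ℕ,
      walkLength (G.toWeightedGraph ι).edgeLength q + G.pot u = ((G.pot v + 2 * c : ℕ) : ℝ≥0∞) ∧
      ∀ p e κ m c', G.Run p e κ v m c' → G.Run p e κ u m (c' + c) := by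
  induction q with
  | nil => exact fun u hu => ⟨u, hu, 0, by simp [walkLength], fun _ _ _ _ _ r => r⟩
  | cons hadj q ih =>
    rintro u hu
    obtain ⟨u', v, hu', rfl, h⟩ := id hadj
    obtain rfl := ι.injective (hu'.trans hu.symm)
    subst hu
    obtain ⟨w, hw, c, hc, hr⟩ := ih v rfl
    rcases h with h | h
    · refine ⟨w, hw, c, ?_, fun p e κ m c' r => .fwd h (hr p e κ m c' r)⟩
      rw [walkLength_cons, add_right_comm, edgeLength_add_pot h, add_comm, hc]
    · refine ⟨w, hw, c + (G.pot u' - G.pot v), ?_, fun p e κ m c' r => ?_⟩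
      · have hlt := G.pot_lt h
        have h2 : ((G.pot u' : ℕ) : ℝ≥0∞) = ((G.pot u' - G.pot v : ℕ) :) + (G.pot v : ℕ) := by
          exact_mod_cast (Nat.sub_add_cancel hlt.le).symm
        have h1 : (G.toWeightedGraph ι).edgeLength s(ι u', ι v) = ((G.pot u' - G.pot v : ℕ) :) := by
          have := edgeLength_add_pot (ι := ι) h
          rw [Sym2.eq_swap] at this
          rw [h2] at this
          exact (ENNReal.add_left_inj (ENNReal.natCast_ne_top _)).1 this
        rw [walkLength_cons, h1, h2]
        calc _ = ((G.pot u' - G.pot v : ℕ) : ℝ≥0∞) + ((G.pot u' - G.pot v : ℕ) :) +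
              (walkLength (G.toWeightedGraph ι).edgeLength q + G.pot v) := by ring
          _ = _ := by rw [hc]; push_cast; ring
      · rw [← add_assoc]
        exact .bwd h (hr p e κ m c' r)

/-- Walk lengths shifted by the potential of `u` are natural numbers, so the infimum is attained. -/
theorem exists_walk_eq_dist {u : V} {y : Fin n} (h : (G.toWeightedGraph ι).dist (ι u) y ≠ ⊤) :
    ∃ q : (G.toWeightedGraph ι).graph.Walk (ι u) y,
      walkLength (G.toWeightedGraph ι).edgeLength q = (G.toWeightedGraph ι).dist (ι u) y := by
  have hL : ∀ q : (G.toWeightedGraph ι).graph.Walk (ι u) y, ∃ L : ℕ,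
      walkLength (G.toWeightedGraph ι).edgeLength q + G.pot u = L := fun q => by
    obtain ⟨v, -, c, hc, -⟩ := exists_prepend q u rfl
    exact ⟨_, hc⟩
  choose L hL using hL
  have : Nonempty ((G.toWeightedGraph ι).graph.Walk (ι u) y) := by
    by_contra hne
    rw [not_nonempty_iff] at hne
    exact h (iInf_of_empty _)
  refine ⟨Function.argmin L, le_antisymm (le_iInf fun q => ?_) (iInf_le _ _)⟩
  refine (ENNReal.add_le_add_iff_right (ENNReal.natCast_ne_top (G.pot u))).1 ?_
  rw [hL, hL]
  exact_mod_cast Function.argmin_le L q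

/-- A walk of finite length in a united graph gives a run whose marked vertices are the vertices of
the walk. -/
theorem exists_run_of_walk {H : Finset (Sym2 (Fin n))} {p : J} {e : V}
    (hH : ∀ u v, s(ι u, ι v) ∈ H → ¬ G.serve u v p) {x y : Fin n}
    (q : ((G.toWeightedGraph ι).unitedGraph H).Walk x y) (hy : ι e = y) :
    ∀ u, ι u = x → walkLength ((G.toWeightedGraph ι).unitedLength H) q ≠ ⊤ →
      ∃ m c : ℕ, G.Run p e u u m c ∧ m ≤ q.length ∧ ((G.pot e + 2 * c : ℕ) : ℝ≥0∞) ≤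
        walkLength ((G.toWeightedGraph ι).unitedLength H) q + G.pot u := by
  induction q with
  | nil =>
    intro u hu _
    obtain rfl := ι.injective (hu.trans hy.symm)
    exact ⟨0, 0, .done (G.not_serve_self _ _), le_rfl, by simp⟩
  | @cons x z y hadj q ih =>
    rintro u rfl hfin
    rw [walkLength_cons] at hfin
    obtain ⟨hf1, hf2⟩ := ENNReal.add_ne_top.1 hfin
    obtain ⟨q', hq', hns⟩ : ∃ q' : (G.toWeightedGraph ι).graph.Walk (ι u) z,
        walkLength (G.toWeightedGraph ι).edgeLength q' =
          (G.toWeightedGraph ι).unitedLength H s(ι u, z) ∧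
        ∀ v, ι v = z → ¬ G.serve u v p := by
      -- A hopset edge unfolds to a shortest walk and is no shortcut by the choice of `p`; any other
      -- hop is an edge of the gadget.
      by_cases hz : s(ι u, z) ∈ H
      · rw [WeightedGraph.unitedLength, if_pos hz] at hf1 ⊢
        obtain ⟨q', hq'⟩ := exists_walk_eq_dist hf1
        exact ⟨q', hq', by rintro v rfl; exact hH u v hz⟩
      · have hadj' : (G.toWeightedGraph ι).graph.Adj (ι u) z := by
          rcases hadj with h | h
          · exact h
          · exact absurd ((SimpleGraph.fromEdgeSet_adj _).1 h).1 hz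
        refine ⟨.cons hadj' .nil, ?_, ?_⟩
        · rw [WeightedGraph.unitedLength, if_neg hz, walkLength_cons]
          simp [walkLength]
        · rintro v rfl
          obtain ⟨u', v', hu', hv', h⟩ := hadj'
          obtain rfl := ι.injective hu'
          obtain rfl := ι.injective hv'
          exact h.elim (fun h => G.not_serve_adj h p) fun h => G.not_serve_adj_symm h p
    obtain ⟨v, hv, c', hc', hr⟩ := exists_prepend q' u rfl
    obtain ⟨m, c, hrun, hm, hc⟩ := ih hy v hv hf2
    refine ⟨m + 1, c + c', hr _ _ _ _ _ (.mark (hns v hv) hrun), by simpa using hm, ?_⟩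
    rw [walkLength_cons, ← hq']
    calc ((G.pot e + 2 * (c + c') : ℕ) : ℝ≥0∞) = (G.pot e + 2 * c : ℕ) + (2 * c' : ℕ) := by
          push_cast; ring
      _ ≤ walkLength ((G.toWeightedGraph ι).unitedLength H) q + G.pot v + (2 * c' : ℕ) := by gcongr
      _ = walkLength ((G.toWeightedGraph ι).unitedLength H) q + (G.pot v + 2 * c' : ℕ) := by
          push_cast; ring
      _ = _ := by rw [← hc']; ring

/-- A set with few edges leaves a port pair without shortcuts. -/
theorem exists_not_serve [Finite J] {H : Finset (Sym2 (Fin n))} (hH : 2 * H.card < Nat.card J) :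
    ∃ p, ∀ u v, s(ι u, ι v) ∈ H → ¬ G.serve u v p := by
  by_contra! hcon
  choose u v hmem hs using hcon
  refine hH.not_ge ((?_ : _ ≤ _).trans (card_orderedPairs_le H))
  rw [← Fintype.card_coe, ← Nat.card_eq_fintype_card]
  refine Nat.card_le_card_of_injective
    (fun p => ⟨(ι (u p), ι (v p)), Finset.mem_filter.2 ⟨Finset.mem_univ _, hmem p⟩⟩) ?_
  intro p q hpq
  simp only [Subtype.mk.injEq, Prod.mk.injEq, EmbeddingLike.apply_eq_iff_eq] at hpq
  have := hs p
  rw [hpq.1, hpq.2] at this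
  exact G.serve_unique this (hs q)

theorem exists_excess_of_isHopset [Finite J] {M S β : ℕ} {ε : ℝ} {H : Finset (Sym2 (Fin n))}
    (hb : G.HopBound 0 M S) (hlen : 0 < G.len) (hε : 0 < ε)
    (hcard : 2 * H.card < Nat.card J) (hH : (G.toWeightedGraph ι).IsHopset β ε H) :
    ∃ c : ℕ, M * S ≤ β * S + M * c ∧ (c : ℝ) ≤ ε * G.len := by
  obtain ⟨p, hp⟩ := exists_not_serve (G := G) (ι := ι) hcard
  have hlen' : (0 : ℝ) < G.len := by exact_mod_cast hlen
  have h1 := hH.2 (ι (G.inp (G.src p))) (ι (G.out (G.tgt p)))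
  -- Relaxing `ε` to `2 * ε` makes the inequality strict, so an actual walk can be taken from the
  -- infimum; the excess is `2 * c`, which gives the factor back.
  have h2 : ENNReal.ofReal (1 + ε) *
      (G.toWeightedGraph ι).dist (ι (G.inp (G.src p))) (ι (G.out (G.tgt p))) <
      ENNReal.ofReal ((1 + 2 * ε) * G.len) := by
    calc _ ≤ ENNReal.ofReal (1 + ε) * (G.len : ℝ≥0∞) := by
          gcongr; exact dist_port_le p
      _ = ENNReal.ofReal ((1 + ε) * G.len) := by
          rw [ENNReal.ofReal_mul (by positivity), ENNReal.ofReal_natCast]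
      _ < _ := by
          rw [ENNReal.ofReal_lt_ofReal_iff (by positivity)]
          gcongr
          linarith
  replace h1 := h1.trans_lt h2
  simp only [hopLimitedDist, iInf_lt_iff] at h1
  obtain ⟨q, hq, hlt⟩ := h1
  obtain ⟨m, c, hr, hm, hc⟩ := exists_run_of_walk hp q rfl _ rfl hlt.ne_top
  refine ⟨c, ?_, ?_⟩
  · calc M * S ≤ m * S + M * c := hb p m c hr (Nat.zero_le _)
      _ ≤ _ := by gcongr; exact hm.trans hq
  · rw [G.pot_inp, G.pot_out, Nat.cast_zero, add_zero] at hc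
    replace hc := hc.trans hlt.le
    rw [← ENNReal.ofReal_natCast, ENNReal.ofReal_le_ofReal_iff (by positivity)] at hc
    push_cast at hc
    linarith

end Gadget

/-! ### Choice of parameters -/

/-- Families of gadgets give lower bounds on the hop numbers of small hopsets. -/
theorem half_pow_le_of_hasHopsetsOfSize {I J V : Type} [Finite J] [Finite V] {G : Gadget I J V}
    {n k h β : ℕ} {ε s : ℝ} (hk : 1 ≤ k) (hh : 1 ≤ h) (hε : 0 < ε)
    (hb : G.HopBound 0 (h ^ k) (h ^ k)) (hlen : G.len = 2 * k * h ^ (k + 1))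
    (hV : Nat.card V ≤ n) (hJ : 2 * s < Nat.card J) (hhε : 4 * k * ε * h ≤ 1)
    (H : HasHopsetsOfSize n β ε s) : (h : ℝ) ^ k / 2 ≤ β := by
  obtain ⟨ι⟩ : Nonempty (V ↪ Fin n) := by
    have := Fintype.ofFinite V
    rw [Nat.card_eq_fintype_card, ← Fintype.card_fin n] at hV
    exact Function.Embedding.nonempty_of_card_le (by simpa using hV)
  obtain ⟨T, hT, hTs⟩ := H (G.toWeightedGraph ι)
  have hcard : 2 * T.card < Nat.card J := by
    have : 2 * (T.card : ℝ) < Nat.card J := by linarith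
    exact_mod_cast this
  obtain ⟨c, hc, hcε⟩ := Gadget.exists_excess_of_isHopset hb
    (by rw [hlen]; positivity) hε hcard hT
  have hc' : h ^ k ≤ β + c := by
    refine Nat.le_of_mul_le_mul_right ?_ (Nat.pow_pos (n := k) hh)
    rw [add_mul, mul_comm c]
    exact hc
  have hc'' : (h : ℝ) ^ k ≤ β + c := by exact_mod_cast hc'
  have : ε * G.len ≤ (h : ℝ) ^ k / 2 := by
    rw [hlen]
    push_cast
    calc ε * (2 * k * (h : ℝ) ^ (k + 1)) = (4 * k * ε * h) * (h ^ k / 2) := by ring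
      _ ≤ 1 * (h ^ k / 2) := by gcongr
      _ = _ := one_mul _
  linarith

/-- At `η = 0` the right-hand side is exactly `1 + 1 / (T - 1)`; continuity leaves room for a
positive `η`. -/
theorem exists_loss {T δ : ℝ} (hT : 1 < T) (hδ : 0 < δ) :
    ∃ η : ℝ, 0 < η ∧ η < 1 ∧
      1 + 1 / (T - 1) - δ < (1 - η) / (2 * (T - 1) + η) * (2 * T) := by
  have hT' : T - 1 ≠ 0 := by linarith
  have hcont : ContinuousAt (fun η : ℝ => (1 - η) / (2 * (T - 1) + η) * (2 * T)) 0 := by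
    refine ContinuousAt.mul (ContinuousAt.div (by fun_prop) (by fun_prop) ?_) continuousAt_const
    simpa using hT'
  have h0 : 1 + 1 / (T - 1) - δ < (1 - 0) / (2 * (T - 1) + 0) * (2 * T) := by
    have : (1 - 0) / (2 * (T - 1) + 0) * (2 * T) = 1 + 1 / (T - 1) := by
      field_simp
      ring
    rw [this]
    linarith
  have h1 := (hcont.eventually (lt_mem_nhds h0)).filter_mono
    (nhdsWithin_le_nhds (s := Set.Ioi 0))
  obtain ⟨η, h2, h3, h4⟩ := (h1.and (Ioo_mem_nhdsGT (one_pos (α := ℝ)))).exists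
  exact ⟨η, h3, h4, h2⟩

theorem eventually_lt_rpow (K : ℝ) {a : ℝ} (ha : 0 < a) :
    ∀ᶠ n : ℕ in atTop, K < (n : ℝ) ^ a :=
  ((tendsto_rpow_atTop ha).comp tendsto_natCast_atTop_atTop).eventually_gt_atTop K

theorem mainTheorem5 (k : ℕ) (hk : 1 ≤ k) :
    ∃ c : ℝ, 0 < c ∧
      ∀ (δ : ℝ), 0 < δ →
      ∀ (ε f : ℕ → ℝ), Tendsto f atTop (𝓝 0) →
        (∀ᶠ n : ℕ in atTop, 1 / (n : ℝ) ^ (f n) < ε n) →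
        ∀ᶠ n : ℕ in atTop, ∀ β : ℕ, 1 ≤ β →
          HasHopsetsOfSize n β (ε n) ((n : ℝ) ^ (1 + 1 / ((2 : ℝ) ^ k - 1) - δ)) →
            c * (1 / ε n) ^ k ≤ (β : ℝ) := by
  have hk' : (1 : ℝ) ≤ k := by exact_mod_cast hk
  refine ⟨1 / 2 * (1 / (8 * k)) ^ k, by positivity, fun δ hδ ε f hf hε => ?_⟩
  have hT : (1 : ℝ) < 2 ^ k := one_lt_pow₀ (by norm_num) (by omega)
  obtain ⟨η, hη, hη1, hexp⟩ := exists_loss hT hδ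
  obtain ⟨C, hC, hfam⟩ := Gadget.hasFamily hk hη hη1.le
  have hC' : (1 : ℝ) ≤ C := by exact_mod_cast hC
  have hden : 0 < 2 * ((2 : ℝ) ^ k - 1) + η := by linarith
  -- Chosen so that with `X ≤ n ^ γ` the vertex bound `n ^ η * X ^ (2 * (2 ^ k - 1) + η)` is at most
  -- `n`.
  set γ : ℝ := (1 - η) / (2 * ((2 : ℝ) ^ k - 1) + η) with hγ
  have hγ0 : 0 < γ := div_pos (by linarith) hden
  filter_upwards [hε, eventually_ge_atTop 1,
    hf.eventually (gt_mem_nhds (show 0 < η / (2 * C) by positivity)),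
    eventually_lt_rpow ((C : ℝ) ^ C) (half_pos hη), eventually_lt_rpow 1 hγ0,
    -- The constant covers the two orientations of a hopset edge and the factor `2` lost in rounding
    -- `X`, raised to the power `2 ^ (k + 1)`.
    eventually_lt_rpow (2 * 2 ^ 2 ^ (k + 1)) (sub_pos.2 hexp)]
    with n hεn hn hfn hCn hXn hbig β hβ H
  have hβ' : (1 : ℝ) ≤ β := by exact_mod_cast hβ
  have hn' : (1 : ℝ) ≤ n := by exact_mod_cast hn
  have hn0 : (0 : ℝ) < n := by linarith
  have hε0 : 0 < ε n := lt_trans (by positivity) hεn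
  have hmono : ∀ {t : ℝ}, 1 / (8 * k * ε n) ≤ t →
      1 / 2 * (1 / (8 * (k : ℝ))) ^ k * (1 / ε n) ^ k ≤ t ^ k / 2 := fun {t} ht => by
    calc _ = (1 / (8 * k * ε n)) ^ k / 2 := by
          rw [mul_assoc, ← mul_pow, one_div_mul_one_div]; ring
      _ ≤ _ := by gcongr
  -- For large `ε` no positive `h` is available, but then the claimed bound is at most `1 / 2`.
  rcases lt_or_ge 1 (4 * k * ε n) with hlarge | hsmall
  · have : 1 / (8 * k * ε n) ≤ 1 := by
      rw [div_le_one (by positivity)]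
      linarith
    have := hmono this
    rw [one_pow] at this
    linarith
  set h : ℕ := ⌊1 / (4 * k * ε n)⌋₊ with hh
  have hz1 : 1 ≤ 1 / (4 * k * ε n) := by rwa [le_div_iff₀ (by positivity), one_mul]
  have hh1 : 1 ≤ h := (Nat.one_le_floor_iff _).2 hz1
  have hhz : (h : ℝ) ≤ 1 / (4 * k * ε n) := Nat.floor_le (by positivity)
  have hhlow : 1 / (8 * k * ε n) ≤ h := by
    have h1 := Nat.lt_floor_add_one (1 / (4 * k * ε n))
    have h2 : (1 : ℝ) ≤ h := by exact_mod_cast hh1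
    have h3 : 1 / (8 * k * ε n) = 1 / (4 * k * ε n) / 2 := by
      rw [div_div]; congr 1; ring
    rw [h3]
    linarith
  -- The only use of the lower bound on `ε`: powers of `h` are negligible against `n ^ η`.
  have hhn : (h : ℝ) ≤ (n : ℝ) ^ (η / (2 * C)) := by
    calc (h : ℝ) ≤ 1 / (4 * k * ε n) := hhz
      _ ≤ 1 / ε n := one_div_le_one_div_of_le hε0 (by nlinarith)
      _ ≤ (n : ℝ) ^ f n := (one_div_le hε0 (by positivity)).2 hεn.le
      _ ≤ _ := Real.rpow_le_rpow_of_exponent_le hn' hfn.le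
  have hCh : ((C : ℝ) * h) ^ C ≤ (n : ℝ) ^ η := by
    calc ((C : ℝ) * h) ^ C = (C : ℝ) ^ C * (h : ℝ) ^ C := mul_pow _ _ _
      _ ≤ (n : ℝ) ^ (η / 2) * ((n : ℝ) ^ (η / (2 * C))) ^ C := by gcongr
      _ = (n : ℝ) ^ η := by
        rw [← Real.rpow_natCast, ← Real.rpow_mul hn0.le, ← Real.rpow_add hn0]
        congr 1
        field_simp
        ring
  set X : ℕ := ⌊(n : ℝ) ^ γ⌋₊ with hX
  have hX1 : 1 ≤ X := (Nat.one_le_floor_iff _).2 hXn.le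
  have hXle : (X : ℝ) ≤ (n : ℝ) ^ γ := Nat.floor_le (by positivity)
  have hXge : (n : ℝ) ^ γ / 2 ≤ X := by
    have h1 := Nat.lt_floor_add_one ((n : ℝ) ^ γ)
    have h2 : (1 : ℝ) ≤ X := by exact_mod_cast hX1
    linarith
  obtain ⟨I, J, V, _, _, _, G, hb, hlen, -, -, hJ, -, hV⟩ := hfam X h hX1 hh1
  refine (hmono hhlow).trans (half_pow_le_of_hasHopsetsOfSize hk hh1 hε0 hb hlen ?_ ?_ ?_ H)
  · have : (Nat.card V : ℝ) ≤ n := by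
      calc _ ≤ _ := hV
        _ ≤ (n : ℝ) ^ η * ((n : ℝ) ^ γ) ^ (2 * ((2 : ℝ) ^ k - 1) + η) := by gcongr
        _ = n := by
          rw [← Real.rpow_mul hn0.le, ← Real.rpow_add hn0, hγ, div_mul_cancel₀ _ hden.ne']
          simp
    exact_mod_cast this
  · have hJ' : (X : ℝ) ^ 2 ^ (k + 1) ≤ Nat.card J := by exact_mod_cast hJ
    refine lt_of_lt_of_le ?_ hJ'
    refine lt_of_lt_of_le ?_ (pow_le_pow_left₀ (by positivity) hXge _)
    rw [div_pow, lt_div_iff₀ (by positivity)]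
    rw [Real.rpow_sub hn0, lt_div_iff₀ (by positivity)] at hbig
    calc _ = 2 * 2 ^ 2 ^ (k + 1) * (n : ℝ) ^ (1 + 1 / ((2 : ℝ) ^ k - 1) - δ) := by ring
      _ < _ := hbig
      _ = _ := by
        rw [← Real.rpow_natCast ((n : ℝ) ^ γ), ← Real.rpow_mul hn0.le]
        congr 2
        push_cast
        ring
  · calc 4 * k * ε n * h ≤ 4 * k * ε n * (1 / (4 * k * ε n)) := by gcongr
      _ = 1 := by field_simp
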